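/- Let $\mathbb F$ be a field and let $0\neq q\in\mathbb F$ be not a root of unity. For $0\ne p\in\mathbb F$ with $p^2\neq 1$ let $U_p(\mathfrak{sl}_2)$ be the $\mathbb F$-algebra with generators $x,y^{\pm1},z$ and relations $yy^{-1}=y^{-1}y=1$, $$\frac{pxy-p^{-1}yx}{p-p^{-1}}=1,\qquad \frac{pyz-p^{-1}zy}{p-p^{-1}}=1,\qquad \frac{pzx-p^{-1}xz}{p-p^{-1}}=1,$$ and in it put $$n_x=\frac{p(1-yz)}{p-p^{-1}},\qquad n_y=\frac{p(1-zx)}{p-p^{-1}},\qquad n_z=\frac{p(1-xy)}{p-p^{-1}}.$$ Let $d\ge 0$ and let $V$ be an irreducible $U_q(\mathfrak{sl}_2)$-module of dimension $d+1$ and type $1$, i.e. the eigenvalues of $y$ on $V$ are $q^{d-2i}$ $(0\le i\le d)$. Let $\dagger:U_q(\mathfrak{sl}_2)\to U_{q^{-1}}(\mathfrak{sl}_2)$ be the antiisomorphism of $\mathbb F$-algebras fixing $x,y,z$, and regard the dual space $V^*$ as a $U_{q^{-1}}(\mathfrak{sl}_2)$-module so that $(\zeta u,f)=(u,\zeta^\dagger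 f)$ for $u\in V$, $f\in V^*$, $\zeta\in U_q(\mathfrak{sl}_2)$, where $(u,f)=f(u)$. For $\xi\in\{x,y,z\}$, a basis $\{v_i\}_{i=0}^d$ of $V$ (resp. $V^*$) is called $[\xi]_{row}$ if $\xi v_i=q^{d-2i}v_i$ (resp. $\xi v_i=q^{2i-d}v_i$) for $0\le i\le d$ and $\sum_{i=0}^d v_i\in n_\xi^dV$ (resp. $n_\xi^dV^*$). The inversion of a basis $\{v_i\}_{i=0}^d$ is $\{v_{d-i}\}_{i=0}^d$. A $[\xi]^{inv}_{row}$ basis is the inversion of a $[\xi]_{row}$ basis. A basis of $V$ (resp. $V^*$) is $[\xi]_{col}$ if it is dual to a $[\xi]^{inv}_{row}$ basis of $V^*$ (resp. $V$), and a $[\xi]^{inv}_{col}$ basis is the inversion of a $[\xi]_{col}$ basis. Index rows and columns of $(d+1)\times(d+1)$ matrices by $0,\dots,d$; a matrix $B$ represents a linear map $A$ with respect to $\{v_i\}$ if $Av_j=\sum_i B_{ij}v_i$. For $p\in\{q,q^{-1}\}$ put $[n]=\frac{p^n-p^{-n}}{p-p^{-1}}$ (the same for both $p$). Let $Z$ have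 $(i,j)$-entry $\delta_{i+j,d}$. Let $N_p$ have $(i,i-1)$-entry $p^{1-i}[i]$ for $1\le i\le d$ and all other entries $0$. Let $T_p$ be the tridiagonal matrix with $(i,i-1)$-entry $p^{3i-2d-1}[i]$ and $(i-1,i)$-entry $-p^{3i-d-2}[d-i+1]$ for $1\le i\le d$, and $(i,i)$-entry $p^{2i-d}[i][d-i+1](p-p^{-1})-p^{2i-d+1}[2i-d]$ for $0\le i\le d$. Write $t$ for transpose. Theorem. (i) With respect to each basis of $V$ of the type in the first column, $n_x,n_y,n_z\in U_q(\mathfrak{sl}_2)$ are represented by the matrices in the table: $$\begin{array}{c|ccc} \text{basis of }V & n_x & n_y & n_z\\ \hline [x]_{row} & T_q & -ZN_{q^{-1}}Z & N_q\\ [x]_{col} & T_q^t & N_q^t & -ZN_{q^{-1}}^tZ\\ [x]^{inv}_{row} & -T_{q^{-1}} & -N_{q^{-1}} & ZN_qZ\\ [x]^{inv}_{col} & -T_{q^{-1}}^t & ZN_q^tZ & -N_{q^{-1}}^t\\ \hline [y]_{row} & N_q & T_q & -ZN_{q^{-1}}Z\\ [y]_{col} & -ZN_{q^{-1}}^tZ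 & T_q^t & N_q^t\\ [y]^{inv}_{row} & ZN_qZ & -T_{q^{-1}} & -N_{q^{-1}}\\ [y]^{inv}_{col} & -N_{q^{-1}}^t & -T_{q^{-1}}^t & ZN_q^tZ\\ \hline [z]_{row} & -ZN_{q^{-1}}Z & N_q & T_q\\ [z]_{col} & N_q^t & -ZN_{q^{-1}}^tZ & T_q^t\\ [z]^{inv}_{row} & -N_{q^{-1}} & ZN_qZ & -T_{q^{-1}}\\ [z]^{inv}_{col} & ZN_q^tZ & -N_{q^{-1}}^t & -T_{q^{-1}}^t \end{array}$$ (ii) With respect to each basis of $V^*$ of the type in the first column, $n_x,n_y,n_z\in U_{q^{-1}}(\mathfrak{sl}_2)$ are represented by the matrices in the table: $$\begin{array}{c|ccc} \text{basis of }V^* & n_x & n_y & n_z\\ \hline [x]_{row} & T_{q^{-1}} & -ZN_qZ & N_{q^{-1}}\\ [x]_{col} & T_{q^{-1}}^t & N_{q^{-1}}^t & -ZN_q^tZ\\ [x]^{inv}_{row} & -T_q & -N_q & ZN_{q^{-1}}Z\\ [x]^{inv}_{col} & -T_q^t & ZN_{q^{-1}}^tZ & -N_q^t\\ \hline [y]_{row}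 & N_{q^{-1}} & T_{q^{-1}} & -ZN_qZ\\ [y]_{col} & -ZN_q^tZ & T_{q^{-1}}^t & N_{q^{-1}}^t\\ [y]^{inv}_{row} & ZN_{q^{-1}}Z & -T_q & -N_q\\ [y]^{inv}_{col} & -N_q^t & -T_q^t & ZN_{q^{-1}}^tZ\\ \hline [z]_{row} & -ZN_qZ & N_{q^{-1}} & T_{q^{-1}}\\ [z]_{col} & N_{q^{-1}}^t & -ZN_q^tZ & T_{q^{-1}}^t\\ [z]^{inv}_{row} & -N_q & ZN_{q^{-1}}Z & -T_q\\ [z]^{inv}_{col} & ZN_{q^{-1}}^tZ & -N_q^t & -T_q^t \end{array}$$ -/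

import Mathlib

noncomputable section

namespace EquitableSl2

universe u v

/-- The equitable generators `x, y, y⁻¹, z`. -/
inductive Generator : Type
  | x | y | yinv | z

/-- `(q a b - q⁻¹ b a)/(q - q⁻¹)`. -/
def qBracket {F : Type u} [Field F] {A : Type v} [Ring A] [Algebra F A] (q : F) (a b : A) : A :=
  (q - q⁻¹)⁻¹ • (q • (a * b) - q⁻¹ • (b * a))

/-- The defining relations of the equitable presentation of `U_q(sl₂)`. -/
inductive Relation (F : Type u) [Field F] (q : F) :
    FreeAlgebra F Generator → FreeAlgebra F Generator → Prop
  | y_yinv : Relation F q (FreeAlgebra.ι F .y * FreeAlgebra.ι F .yinv) 1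
  | yinv_y : Relation F q (FreeAlgebra.ι F .yinv * FreeAlgebra.ι F .y) 1
  | xy : Relation F q (qBracket q (FreeAlgebra.ι F .x) (FreeAlgebra.ι F .y)) 1
  | yz : Relation F q (qBracket q (FreeAlgebra.ι F .y) (FreeAlgebra.ι F .z)) 1
  | zx : Relation F q (qBracket q (FreeAlgebra.ι F .z) (FreeAlgebra.ι F .x)) 1

/-- The algebra `U_q(sl₂)` over `F`, in the equitable presentation. -/
def Uq (F : Type u) [Field F] (q : F) : Type u := RingQuot (Relation F q)

instance (F : Type u) [Field F] (q : F) : Ring (Uq F q) :=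
  inferInstanceAs (Ring (RingQuot (Relation F q)))

instance (F : Type u) [Field F] (q : F) : Algebra F (Uq F q) :=
  inferInstanceAs (Algebra F (RingQuot (Relation F q)))

section algebra

variable {F : Type u} [Field F]

/-- The quotient map onto `U_q(sl₂)`. -/
def Uq.mk (q : F) : FreeAlgebra F Generator →ₐ[F] Uq F q :=
  RingQuot.mkAlgHom F (Relation F q)

/-- The images of the generators in `U_q(sl₂)`. -/
def Uq.of (q : F) (g : Generator) : Uq F q :=
  Uq.mk q (FreeAlgebra.ι F g)

def Uq.x (q : F) : Uq F q := Uq.of q .x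
def Uq.y (q : F) : Uq F q := Uq.of q .y
def Uq.z (q : F) : Uq F q := Uq.of q .z

/-- `n_x = q(1-yz)/(q-q⁻¹)`. -/
def Uq.nx (q : F) : Uq F q := (q / (q - q⁻¹)) • (1 - Uq.y q * Uq.z q)
/-- `n_y = q(1-zx)/(q-q⁻¹)`. -/
def Uq.ny (q : F) : Uq F q := (q / (q - q⁻¹)) • (1 - Uq.z q * Uq.x q)
/-- `n_z = q(1-xy)/(q-q⁻¹)`. -/
def Uq.nz (q : F) : Uq F q := (q / (q - q⁻¹)) • (1 - Uq.x q * Uq.y q)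

theorem map_qBracket {A : Type*} {B : Type*} [Ring A] [Algebra F A] [Ring B] [Algebra F B]
    (f : A →ₐ[F] B) (q : F) (a b : A) : f (qBracket q a b) = qBracket q (f a) (f b) := by
  simp [qBracket]

theorem Uq.of_rel {q : F} {a b : FreeAlgebra F Generator} (h : Relation F q a b) :
    FreeAlgebra.lift F (Uq.of q) a = FreeAlgebra.lift F (Uq.of q) b := by
  have e : FreeAlgebra.lift F (Uq.of q) = Uq.mk q := by
    apply FreeAlgebra.hom_ext
    funext g; simp [Uq.of]
  rw [e]
  exact RingQuot.mkAlgHom_rel F h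

theorem Uq.hom_ext {q : F} {A : Type*} [Semiring A] [Algebra F A] {f g : Uq F q →ₐ[F] A}
    (h : ∀ s, f (Uq.of q s) = g (Uq.of q s)) : f = g := by
  apply RingQuot.ringQuot_ext'
  apply FreeAlgebra.hom_ext
  funext s
  exact h s

/-- The algebra homomorphism from `U_q` to the opposite of `U_p`, where `p = q⁻¹`, that sends
each equitable generator to the generator of the same name. -/
def antiHom {q p : F} (h : p = q⁻¹) : Uq F q →ₐ[F] (Uq F p)ᵐᵒᵖ :=
  RingQuot.liftAlgHom F ⟨FreeAlgebra.lift F fun g => MulOpposite.op (Uq.of p g), by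
    have key : ∀ a b : Uq F p, qBracket q (MulOpposite.op a) (MulOpposite.op b)
        = MulOpposite.op (qBracket p a b) := by
      intro a b
      have e : (p - p⁻¹)⁻¹ = -(q - q⁻¹)⁻¹ := by
        rw [h, inv_inv, ← inv_neg, neg_sub]
      have e' : p⁻¹ = q := by rw [h, inv_inv]
      simp only [qBracket, ← MulOpposite.op_mul, ← MulOpposite.op_smul, ← MulOpposite.op_sub]
      rw [e, e', ← h, neg_smul, ← smul_neg, neg_sub]
    intro a b r
    cases r with
    | y_yinv =>
      have := Uq.of_rel (Relation.yinv_y (F := F) (q := p))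
      simp only [map_mul, map_one, FreeAlgebra.lift_ι_apply] at this ⊢
      rw [← MulOpposite.op_mul, this, MulOpposite.op_one]
    | yinv_y =>
      have := Uq.of_rel (Relation.y_yinv (F := F) (q := p))
      simp only [map_mul, map_one, FreeAlgebra.lift_ι_apply] at this ⊢
      rw [← MulOpposite.op_mul, this, MulOpposite.op_one]
    | xy =>
      have := Uq.of_rel (Relation.xy (F := F) (q := p))
      simp only [map_qBracket, map_one, FreeAlgebra.lift_ι_apply] at this ⊢
      rw [key, this, MulOpposite.op_one]
    | yz =>
      have := Uq.of_rel (Relation.yz (F := F) (q := p))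
      simp only [map_qBracket, map_one, FreeAlgebra.lift_ι_apply] at this ⊢
      rw [key, this, MulOpposite.op_one]
    | zx =>
      have := Uq.of_rel (Relation.zx (F := F) (q := p))
      simp only [map_qBracket, map_one, FreeAlgebra.lift_ι_apply] at this ⊢
      rw [key, this, MulOpposite.op_one]⟩

theorem antiHom_of {q p : F} (h : p = q⁻¹) (g : Generator) :
    antiHom h (Uq.of q g) = MulOpposite.op (Uq.of p g) := by
  refine (RingQuot.liftAlgHom_mkAlgHom_apply F _ _ _).trans ?_
  simp

theorem antiHom_antiHom {q p : F} (h : p = q⁻¹) (h' : q = p⁻¹) (a : Uq F q) :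
    (antiHom h' (antiHom h a).unop).unop = a := by
  have e : (AlgHom.opComm (antiHom h')).comp (antiHom h) = AlgHom.id F (Uq F q) := by
    apply Uq.hom_ext
    intro s
    simp [antiHom_of]
  have := DFunLike.congr_fun e a
  simpa using this

/-- The antiisomorphism `† : U_q(sl₂) → U_{q⁻¹}(sl₂)` that fixes the equitable generators,
as an isomorphism onto the opposite algebra. -/
def dagger (q : F) : Uq F q ≃ₐ[F] (Uq F q⁻¹)ᵐᵒᵖ :=
  { antiHom (rfl : q⁻¹ = q⁻¹) with
    invFun := fun b => (antiHom (inv_inv q).symm b.unop).unop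
    left_inv := fun a => antiHom_antiHom rfl (inv_inv q).symm a
    right_inv := fun b => MulOpposite.unop_injective
      (antiHom_antiHom (inv_inv q).symm rfl b.unop) }

theorem dagger_of (q : F) (g : Generator) :
    dagger q (Uq.of q g) = MulOpposite.op (Uq.of q⁻¹ g) :=
  antiHom_of rfl g

variable {V : Type v} [AddCommGroup V] [Module F V]

/-- The action of `U_q(sl₂)` on a module, as a homomorphism to `End(V)`. -/
def moduleRep (q : F) (V : Type v) [AddCommGroup V] [Module F V] [Module (Uq F q) V]
    [IsScalarTower F (Uq F q) V] : Uq F q →ₐ[F] Module.End F V :=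
  Algebra.lsmul F F V

/-- The representation of `U_{q⁻¹}(sl₂)` on the dual space `V*` in which `ζ†` acts as the adjoint
of the action of `ζ` on `V`. -/
def dualRep {q : F} (ρ : Uq F q →ₐ[F] Module.End F V) :
    Uq F q⁻¹ →ₐ[F] Module.End F (Module.Dual F V) :=
  AlgHom.ofLinearMap
    { toFun := fun ζ => (ρ ((dagger q).symm (MulOpposite.op ζ))).dualMap
      map_add' := by intro a b; ext f u; simp
      map_smul' := by intro c a; ext f u; simp }
    (by ext f u; simp)
    (by intro a b; ext f u; simp)

/-- `(ζ u, f) = (u, ζ† f)` for the pairing `(u, f) = f u` of `V` and `V*`. -/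
theorem dualRep_dagger {q : F} (ρ : Uq F q →ₐ[F] Module.End F V) (ζ : Uq F q) (u : V)
    (f : Module.Dual F V) : f (ρ ζ u) = dualRep ρ (dagger q ζ).unop f u := by
  simp [dualRep]

end algebra

section bases

variable {F : Type u} [Field F] {V : Type v} [AddCommGroup V] [Module F V]

/-- A representation of `U_q(sl₂)` of dimension `d + 1` has type `ε` when the eigenvalues of `y`
are `ε q^{d-2i}` for `0 ≤ i ≤ d`. -/
def HasType {q : F} (ρ : Uq F q →ₐ[F] Module.End F V) (d : ℕ) (ε : F) : Prop :=
  {μ : F | (ρ (Uq.y q)).HasEigenvalue μ} =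
    {μ : F | ∃ i : Fin (d + 1), μ = ε * q ^ ((d : ℤ) - 2 * (i : ℤ))}

/-- The labels of the three equitable generators `x, y, z`. -/
inductive Axis : Type
  | x | y | z

def Uq.gen (q : F) : Axis → Uq F q
  | .x => Uq.x q
  | .y => Uq.y q
  | .z => Uq.z q

def Uq.nil (q : F) : Axis → Uq F q
  | .x => Uq.nx q
  | .y => Uq.ny q
  | .z => Uq.nz q

/-- Component `i` of the decomposition `[ξ]` attached to a representation of `U_q(sl₂)`: the
eigenspace of `ξ` for the eigenvalue `q^{d-2i}`. For the representation of `U_{q⁻¹}(sl₂)` on `V*`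
the parameter is `q⁻¹`, so there the eigenvalue is `(q⁻¹)^{d-2i} = q^{2i-d}`. -/
def component {q : F} (ρ : Uq F q →ₐ[F] Module.End F V) (d : ℕ) (ξ : Axis)
    (i : Fin (d + 1)) : Submodule F V :=
  (ρ (Uq.gen q ξ)).eigenspace (q ^ ((d : ℤ) - 2 * (i : ℤ)))

variable {d : ℕ}

/-- The inversion `v_d, …, v_0` of a basis `v_0, …, v_d`. -/
def inversion (v : Module.Basis (Fin (d + 1)) F V) : Module.Basis (Fin (d + 1)) F V :=
  v.reindex Fin.revPerm

/-- `v` is a `[ξ]_row` basis. -/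
def IsRow {q : F} (ρ : Uq F q →ₐ[F] Module.End F V) (ξ : Axis)
    (v : Module.Basis (Fin (d + 1)) F V) : Prop :=
  (∀ i, v i ∈ component ρ d ξ i) ∧ ∑ i, v i ∈ LinearMap.range (ρ (Uq.nil q ξ) ^ d)

/-- `v` is a `[ξ]^inv_row` basis: the inversion of a `[ξ]_row` basis. -/
def IsInvRow {q : F} (ρ : Uq F q →ₐ[F] Module.End F V) (ξ : Axis)
    (v : Module.Basis (Fin (d + 1)) F V) : Prop :=
  ∃ w : Module.Basis (Fin (d + 1)) F V, IsRow ρ ξ w ∧ v = inversion w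

/-- A basis of `V` and a basis of `V*` are dual. -/
def AreDual (u : Module.Basis (Fin (d + 1)) F V)
    (f : Module.Basis (Fin (d + 1)) F (Module.Dual F V)) : Prop :=
  ∀ i j, f j (u i) = if i = j then 1 else 0

/-- `v` is a `[ξ]_col` basis of `V`: it is dual to a `[ξ]^inv_row` basis of `V*`. -/
def IsCol {q : F} (ρ : Uq F q →ₐ[F] Module.End F V) (ξ : Axis)
    (v : Module.Basis (Fin (d + 1)) F V) : Prop :=
  ∃ f : Module.Basis (Fin (d + 1)) F (Module.Dual F V), IsInvRow (dualRep ρ) ξ f ∧ AreDual v f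

/-- `v` is a `[ξ]^inv_col` basis of `V`: the inversion of a `[ξ]_col` basis of `V`. -/
def IsInvCol {q : F} (ρ : Uq F q →ₐ[F] Module.End F V) (ξ : Axis)
    (v : Module.Basis (Fin (d + 1)) F V) : Prop :=
  ∃ w : Module.Basis (Fin (d + 1)) F V, IsCol ρ ξ w ∧ v = inversion w

/-- `f` is a `[ξ]_col` basis of `V*`: it is dual to a `[ξ]^inv_row` basis of `V`. -/
def IsDualCol {q : F} (ρ : Uq F q →ₐ[F] Module.End F V) (ξ : Axis)
    (f : Module.Basis (Fin (d + 1)) F (Module.Dual F V)) : Prop :=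
  ∃ v : Module.Basis (Fin (d + 1)) F V, IsInvRow ρ ξ v ∧ AreDual v f

/-- `f` is a `[ξ]^inv_col` basis of `V*`: the inversion of a `[ξ]_col` basis of `V*`. -/
def IsDualInvCol {q : F} (ρ : Uq F q →ₐ[F] Module.End F V) (ξ : Axis)
    (f : Module.Basis (Fin (d + 1)) F (Module.Dual F V)) : Prop :=
  ∃ g : Module.Basis (Fin (d + 1)) F (Module.Dual F V), IsDualCol ρ ξ g ∧ f = inversion g

/-- The matrices `A, B, C` represent `n_x, n_y, n_z` with respect to the basis `v`. -/
def NilMatrices {q : F} (ρ : Uq F q →ₐ[F] Module.End F V) (v : Module.Basis (Fin (d + 1)) F V)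
    (A B C : Matrix (Fin (d + 1)) (Fin (d + 1)) F) : Prop :=
  LinearMap.toMatrix v v (ρ (Uq.nx q)) = A ∧
  LinearMap.toMatrix v v (ρ (Uq.ny q)) = B ∧
  LinearMap.toMatrix v v (ρ (Uq.nz q)) = C

end bases

section matrices

variable {F : Type u} [Field F]

/-- `[n] = (qⁿ - q⁻ⁿ)/(q - q⁻¹)`. -/
def qInt (q : F) (n : ℤ) : F := (q ^ n - q ^ (-n)) / (q - q⁻¹)

/-- The matrix `Z` with `(i,j)`-entry `δ_{i+j,d}`. -/
def Z (F : Type u) [Field F] (d : ℕ) : Matrix (Fin (d + 1)) (Fin (d + 1)) F :=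
  Matrix.of fun i j => if (i : ℕ) + (j : ℕ) = d then 1 else 0

/-- The matrix `N_q`, with `(i,i-1)`-entry `q^{1-i}[i]` and all other entries `0`. -/
def N (d : ℕ) (q : F) : Matrix (Fin (d + 1)) (Fin (d + 1)) F :=
  Matrix.of fun i j =>
    if (i : ℕ) = (j : ℕ) + 1 then q ^ (1 - (i : ℤ)) * qInt q (i : ℤ) else 0

/-- The tridiagonal matrix `T_q`, with `(i,i-1)`-entry `q^{3i-2d-1}[i]`, `(i-1,i)`-entry
`-q^{3i-d-2}[d-i+1]` and `(i,i)`-entry `q^{2i-d}[i][d-i+1](q-q⁻¹) - q^{2i-d+1}[2i-d]`. -/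
def T (d : ℕ) (q : F) : Matrix (Fin (d + 1)) (Fin (d + 1)) F :=
  Matrix.of fun i j =>
    if (i : ℕ) = (j : ℕ) + 1 then
      q ^ (3 * (i : ℤ) - 2 * (d : ℤ) - 1) * qInt q (i : ℤ)
    else if (j : ℕ) = (i : ℕ) + 1 then
      -(q ^ (3 * (j : ℤ) - (d : ℤ) - 2) * qInt q ((d : ℤ) - (j : ℤ) + 1))
    else if i = j then
      q ^ (2 * (i : ℤ) - (d : ℤ)) * qInt q (i : ℤ) * qInt q ((d : ℤ) - (i : ℤ) + 1) * (q - q⁻¹)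
        - q ^ (2 * (i : ℤ) - (d : ℤ) + 1) * qInt q (2 * (i : ℤ) - (d : ℤ))
    else 0

/-- Conjugation by `Z`, that is `B ↦ Z B Z`. -/
def conjZ {d : ℕ} (B : Matrix (Fin (d + 1)) (Fin (d + 1)) F) :
    Matrix (Fin (d + 1)) (Fin (d + 1)) F :=
  Z F d * B * Z F d

end matrices

end EquitableSl2

end

/-!
The defining relations and the nilpotent elements are invariant under the cyclic shift
`x → y → z → x`, so let `(a, b, c)` be any cyclic shift of `(x, y, z)`, and let `v` be an `[a]_row` basis. Since
`a` is diagonal with entries `q^{d-2i}`, the relation between `a` and `b` forces `b` to be lower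
bidiagonal with diagonal `q^{2i-d}`, and the one between `c` and `a` forces `c` to be upper
bidiagonal with the same diagonal (`qBracket_diagMat_left`, `qBracket_diagMat_right`). In
particular the eigenvalues of `b` are the `q^{2i-d}`.

The normalization fixes the remaining entries. From `n_a b = q² b n_a` the operator `n_a` divides
eigenvalues of `b` by `q²`, so `n_a ^ d` maps everything into the eigenspace of `b` for `q^{-d}`
(`apply_eq_of_mem_range_pow`). The relation between `b` and `c`, together with the fact that
`q^{-d-2}` is not an eigenvalue of `b`, then shows that `∑ i, v i` is also an eigenvector of `c`,
for `q^d` (`apply_eq_of_qBracket`). Thus the row sums of both bidiagonal matrices are known, and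
with them the matrices (`eq_lowerMat_and_eq_upperMat`). Multiplying out gives `T_q`, `-Z N_{q⁻¹} Z`
and `N_q` for `n_a`, `n_b`, `n_c` (`toMatrix_nilOf`).

The rest of the table follows formally. Inverting a basis conjugates matrices by `Z`, and
`Z T_q Z = -T_{q⁻¹}` (`conjZ_T`). The antiisomorphism `†` sends each nilpotent element of `U_q` to the
negative of its namesake in `U_{q⁻¹}` (`nilOf_op`), so passing to a dual basis replaces each matrix
by the negative of its transpose (`AreDual.toMatrix_dualRep`). The dual space is a representation
of `U_{q⁻¹}`, to which the result on row bases applies with `q⁻¹` in place of `q`.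
-/

noncomputable section

namespace EquitableSl2

variable {F : Type*} [Field F] {q : F} {d : ℕ}

/-! ### Roots of unity and the relations -/

theorem zpow_injective_of_pow_ne_one (hq0 : q ≠ 0) (hq : ∀ n : ℕ, 0 < n → q ^ n ≠ 1) :
    Function.Injective fun n : ℤ => q ^ n := by
  intro m n h
  by_contra hne
  have h1 : q ^ (m - n) = 1 := by
    rw [zpow_sub₀ hq0]
    exact div_eq_one_iff_eq (zpow_ne_zero n hq0) |>.2 h
  refine hq (m - n).natAbs (Int.natAbs_pos.2 (sub_ne_zero.2 hne)) ?_
  rcases Int.natAbs_eq (m - n) with h2 | h2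
  · rwa [h2, zpow_natCast] at h1
  · rwa [h2, zpow_neg, inv_eq_one, zpow_natCast] at h1

theorem sub_inv_ne_zero (hq0 : q ≠ 0) (hq : ∀ n : ℕ, 0 < n → q ^ n ≠ 1) : q - q⁻¹ ≠ 0 := by
  intro h
  refine hq 2 two_pos ?_
  rw [sub_eq_zero] at h
  rw [sq]
  nth_rewrite 1 [h]
  exact inv_mul_cancel₀ hq0

theorem qBracket_eq_one_iff {A : Type*} [Ring A] [Algebra F A] (hs : q - q⁻¹ ≠ 0) {a b : A} :
    qBracket q a b = 1 ↔ q • (a * b) - q⁻¹ • (b * a) = (q - q⁻¹) • (1 : A) := by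
  rw [qBracket, inv_smul_eq_iff₀ hs]

/-- The element `q(1 - bc)/(q - q⁻¹)`, which is `n_x` for `(b, c) = (y, z)`, and cyclically. -/
def nilOf {A : Type*} [Ring A] [Algebra F A] (q : F) (b c : A) : A :=
  (q / (q - q⁻¹)) • (1 - b * c)

theorem map_nilOf {A B : Type*} [Ring A] [Algebra F A] [Ring B] [Algebra F B]
    (f : A →ₐ[F] B) (q : F) (a b : A) : f (nilOf q a b) = nilOf q (f a) (f b) := by
  simp [nilOf]

/-- The relation between `b` and `c` makes `n_a = nilOf q b c` commute with `b` up to the factor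
`q²`. -/
theorem nilOf_mul_left {A : Type*} [Ring A] [Algebra F A] (hq0 : q ≠ 0) (hs : q - q⁻¹ ≠ 0)
    {b c : A} (h : qBracket q b c = 1) :
    nilOf q b c * b = q ^ 2 • (b * nilOf q b c) := by
  rw [qBracket_eq_one_iff hs] at h
  have h2 : c * b = q ^ 2 • (b * c) - (q ^ 2 - 1) • (1 : A) := by
    have h3 := congrArg (fun t => q • t) h
    simp only [smul_sub, smul_smul, mul_inv_cancel₀ hq0, one_smul] at h3
    rw [show q * (q - q⁻¹) = q ^ 2 - 1 by field_simp, ← sq] at h3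
    rw [← h3]; abel
  rw [nilOf, smul_mul_assoc, mul_smul_comm, smul_comm (q ^ 2)]
  congr 1
  rw [sub_mul, one_mul, mul_assoc, h2, mul_sub, mul_sub, mul_smul_comm, mul_smul_comm, mul_one,
    smul_sub, sub_smul, one_smul]
  abel

/-! ### Eigenvalue shifting -/

section eigen

variable {W : Type*} [AddCommGroup W] [Module F W]

/-- Since `n b = q² b n`, the operator `n` lowers eigenvalues of `b` by a factor `q⁻²`. When the
eigenvalues of `b` are the `d + 1` numbers `q^{2i-d}`, only the eigenvector for `q^d` survives
`n ^ d`, and it is carried to the eigenvalue `q^{-d}`. -/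
theorem apply_eq_of_mem_range_pow (hq0 : q ≠ 0) (hq : ∀ n : ℕ, 0 < n → q ^ n ≠ 1)
    (hdim : Module.finrank F W = d + 1) (b n : Module.End F W)
    (hb : ∀ μ, b.HasEigenvalue μ ↔ ∃ i : Fin (d + 1), μ = q ^ (2 * (i : ℤ) - d))
    (hn : n * b = q ^ 2 • (b * n)) {w : W} (hw : w ∈ LinearMap.range (n ^ d)) :
    b w = q ^ (-(d : ℤ)) • w := by
  have hinj := zpow_injective_of_pow_ne_one hq0 hq
  have hev (i : Fin (d + 1)) : ∃ u, b.HasEigenvector (q ^ (2 * (i : ℤ) - d)) u :=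
    ((hb _).2 ⟨i, rfl⟩).exists_hasEigenvector
  choose u hu using hev
  have hli : LinearIndependent F u := by
    refine b.eigenvectors_linearIndependent' (fun i : Fin (d + 1) => q ^ (2 * (i : ℤ) - d)) ?_ u hu
    intro i j hij
    have := hinj hij
    ext; omega
  let B := basisOfLinearIndependentOfCardEqFinrank hli (by simp [hdim])
  have hstep (k : ℕ) (m : ℤ) (t : W) (ht : b t = q ^ m • t) :
      b ((n ^ k) t) = q ^ (m - 2 * k) • (n ^ k) t := by
    induction k with
    | zero => simpa using ht
    | succ k ih =>
      have h1 := congrArg (fun f : Module.End F W => f ((n ^ k) t)) hn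
      simp only [Module.End.mul_apply, LinearMap.smul_apply, ih, map_smul] at h1
      rw [pow_succ', Module.End.mul_apply]
      have h2 : b (n ((n ^ k) t)) = (q ^ 2)⁻¹ • q ^ (m - 2 * (k : ℤ)) • n ((n ^ k) t) := by
        rw [h1, inv_smul_smul₀ (pow_ne_zero 2 hq0)]
      rw [h2, smul_smul]
      congr 1
      rw [show m - 2 * ((k + 1 : ℕ) : ℤ) = -2 + (m - 2 * (k : ℤ)) by push_cast; ring,
        zpow_add₀ hq0]
      simp [zpow_neg]
  obtain ⟨t, rfl⟩ := hw
  have key : b * n ^ d = q ^ (-(d : ℤ)) • n ^ d := by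
    refine B.ext fun i => ?_
    have hBi : B i = u i := by simp [B]
    rw [hBi, Module.End.mul_apply, LinearMap.smul_apply]
    have h1 := hstep d _ _ (hu i).apply_eq_smul
    by_cases h0 : (n ^ d) (u i) = 0
    · simp [h0]
    -- a nonzero image is an eigenvector for `q^{2i-3d}`, which is an eigenvalue only if `i = d`
    have h2 : b.HasEigenvalue (q ^ (2 * (i : ℤ) - d - 2 * d)) :=
      Module.End.hasEigenvalue_of_hasEigenvector ⟨Module.End.mem_eigenspace_iff.2 h1, h0⟩
    obtain ⟨j, hj⟩ := (hb _).1 h2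
    have h3 := hinj hj
    have h4 : 2 * (i : ℤ) - d - 2 * d = -(d : ℤ) := by omega
    rw [h1, h4]
  exact congrArg (fun f : Module.End F W => f t) key

/-- If `w` is a `q^{-d}`-eigenvector of `b`, the relation between `b` and `c` makes `c w - q^d w`
an eigenvector of `b` for `q^{-d-2}` or zero; the former is not an eigenvalue of `b`. -/
theorem apply_eq_of_qBracket (hq0 : q ≠ 0) (hq : ∀ n : ℕ, 0 < n → q ^ n ≠ 1)
    (b c : Module.End F W)
    (hb : ∀ μ, b.HasEigenvalue μ ↔ ∃ i : Fin (d + 1), μ = q ^ (2 * (i : ℤ) - d))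
    (hbc : qBracket q b c = 1) {w : W} (hw : b w = q ^ (-(d : ℤ)) • w) :
    c w = q ^ (d : ℤ) • w := by
  by_contra hne
  rw [qBracket_eq_one_iff (sub_inv_ne_zero hq0 hq)] at hbc
  have h1 := congrArg (fun f : Module.End F W => f w) hbc
  simp only [Module.End.mul_apply, LinearMap.smul_apply, LinearMap.sub_apply, hw, map_smul,
    Module.End.one_apply] at h1
  have h2 : b (c w) = q⁻¹ • (q⁻¹ • q ^ (-(d : ℤ)) • c w + (q - q⁻¹) • w) := by
    rw [eq_inv_smul_iff₀ hq0, ← h1]; abel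
  have h3 : b (c w - q ^ (d : ℤ) • w) = q ^ (-(d : ℤ) - 2) • (c w - q ^ (d : ℤ) • w) := by
    rw [map_sub, map_smul, h2, hw]
    match_scalars
    · rw [zpow_sub₀ hq0]; field_simp
    · rw [zpow_sub₀ hq0, zpow_neg]
      have := zpow_ne_zero (d : ℤ) hq0
      norm_cast at this ⊢
      field_simp
      ring
  have h4 : b.HasEigenvalue (q ^ (-(d : ℤ) - 2)) :=
    Module.End.hasEigenvalue_of_hasEigenvector
      ⟨Module.End.mem_eigenspace_iff.2 h3, sub_ne_zero.2 hne⟩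
  obtain ⟨j, hj⟩ := (hb _).1 h4
  have := zpow_injective_of_pow_ne_one hq0 hq hj
  omega

end eigen

/-! ### The generators in a normalized eigenbasis -/

section matrices

open Matrix

/-- The lower bidiagonal matrix of `b` in an eigenbasis of `a` whose sum lies in the range of
`n_a ^ d`. All row sums are `q^{-d}`. -/
def lowerMat (d : ℕ) (q : F) : Matrix (Fin (d + 1)) (Fin (d + 1)) F :=
  Matrix.of fun i j =>
    if i = j then q ^ (2 * (i : ℤ) - d)
    else if (i : ℕ) = (j : ℕ) + 1 then q ^ (-(d : ℤ)) - q ^ (2 * (i : ℤ) - d)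
    else 0

/-- The upper bidiagonal matrix of `c` in an eigenbasis of `a` whose sum lies in the range of
`n_a ^ d`. All row sums are `q^d`. -/
def upperMat (d : ℕ) (q : F) : Matrix (Fin (d + 1)) (Fin (d + 1)) F :=
  Matrix.of fun i j =>
    if i = j then q ^ (2 * (i : ℤ) - d)
    else if (j : ℕ) = (i : ℕ) + 1 then q ^ (d : ℤ) - q ^ (2 * (i : ℤ) - d)
    else 0

/-- The diagonal matrix of `a` in an eigenbasis of `a`. -/
def diagMat (d : ℕ) (q : F) : Matrix (Fin (d + 1)) (Fin (d + 1)) F :=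
  diagonal fun i => q ^ ((d : ℤ) - 2 * (i : ℤ))

/-- The `(i, j)`-entry of the relation is `(q θ_i - q⁻¹ θ_j) B_ij = (q - q⁻¹) δ_ij`, where
`θ_i = q^{d-2i}`, and off the diagonal the factor vanishes only for `i = j + 1`. -/
theorem qBracket_diagMat_left (hq0 : q ≠ 0) (hq : ∀ n : ℕ, 0 < n → q ^ n ≠ 1)
    {B : Matrix (Fin (d + 1)) (Fin (d + 1)) F} (h : qBracket q (diagMat d q) B = 1) :
    (∀ i, B i i = q ^ (2 * (i : ℤ) - d)) ∧
      ∀ i j : Fin (d + 1), i ≠ j → (i : ℕ) ≠ (j : ℕ) + 1 → B i j = 0 := by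
  have hs := sub_inv_ne_zero hq0 hq
  rw [qBracket_eq_one_iff hs] at h
  have he (i j) := congrFun (congrFun h i) j
  simp only [diagMat, Matrix.sub_apply, Matrix.smul_apply, diagonal_mul, mul_diagonal,
    smul_eq_mul] at he
  constructor
  · intro i
    have h1 := he i i
    rw [one_apply_eq] at h1
    have h2 : (q - q⁻¹) * (q ^ ((d : ℤ) - 2 * (i : ℤ)) * B i i) = (q - q⁻¹) * 1 := by
      rw [← h1]; ring
    have h3 := mul_left_cancel₀ hs h2
    rw [show (2 * (i : ℤ) - d) = -((d : ℤ) - 2 * (i : ℤ)) by ring, _root_.zpow_neg]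
    exact eq_inv_of_mul_eq_one_right h3
  · intro i j hij hij'
    have h1 := he i j
    rw [one_apply_ne hij, mul_zero] at h1
    have h2 : (q ^ ((d : ℤ) - 2 * (i : ℤ) + 1) - q ^ ((d : ℤ) - 2 * (j : ℤ) - 1)) * B i j = 0 := by
      rw [← h1, zpow_add_one₀ hq0, zpow_sub_one₀ hq0]; ring
    refine (mul_eq_zero.1 h2).resolve_left fun h3 => ?_
    have := zpow_injective_of_pow_ne_one hq0 hq (sub_eq_zero.1 h3)
    omega

theorem qBracket_diagMat_right (hq0 : q ≠ 0) (hq : ∀ n : ℕ, 0 < n → q ^ n ≠ 1)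
    {C : Matrix (Fin (d + 1)) (Fin (d + 1)) F} (h : qBracket q C (diagMat d q) = 1) :
    (∀ i, C i i = q ^ (2 * (i : ℤ) - d)) ∧
      ∀ i j : Fin (d + 1), i ≠ j → (j : ℕ) ≠ (i : ℕ) + 1 → C i j = 0 := by
  have h' : qBracket q (diagMat d q) Cᵀ = 1 := by
    have := congrArg transpose h
    simpa [qBracket, diagMat, transpose_smul, transpose_sub, transpose_mul] using this
  obtain ⟨h1, h2⟩ := qBracket_diagMat_left hq0 hq h'
  exact ⟨h1, fun i j hij hij' => h2 j i hij.symm hij'⟩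

/-- The relations with the diagonal matrix and the normalization of the eigenbasis (the all-ones
vector lies in the range of the `d`-th power of `n_a`) determine `b` and `c`. -/
theorem eq_lowerMat_and_eq_upperMat (hq0 : q ≠ 0) (hq : ∀ n : ℕ, 0 < n → q ^ n ≠ 1)
    {B C : Matrix (Fin (d + 1)) (Fin (d + 1)) F} (hB : qBracket q (diagMat d q) B = 1)
    (hC : qBracket q C (diagMat d q) = 1) (hBC : qBracket q B C = 1) {w : Fin (d + 1) → F}
    (hw : (nilOf q B C ^ d) *ᵥ w = 1) : B = lowerMat d q ∧ C = upperMat d q := by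
  have hs := sub_inv_ne_zero hq0 hq
  obtain ⟨hB1, hB2⟩ := qBracket_diagMat_left hq0 hq hB
  obtain ⟨hC1, hC2⟩ := qBracket_diagMat_right hq0 hq hC
  have htri : Bᵀ.IsUpperTriangular := fun i j (hij : j < i) =>
    hB2 j i hij.ne (by have : (j : ℕ) < i := hij; omega)
  let e : Matrix (Fin (d + 1)) (Fin (d + 1)) F ≃ₐ[F] Module.End F (Fin (d + 1) → F) :=
    Matrix.toLinAlgEquiv'
  -- `B` is triangular, so its eigenvalues are its diagonal entries
  have hchar : LinearMap.charpoly (e B) =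
      ∏ i : Fin (d + 1), (Polynomial.X - Polynomial.C (q ^ (2 * (i : ℤ) - d))) := by
    rw [← LinearMap.charpoly_toMatrix (e B) (Pi.basisFun F _)]
    change (LinearMap.toMatrix' (Matrix.toLin' B)).charpoly = _
    rw [LinearMap.toMatrix'_toLin', ← charpoly_transpose, charpoly_of_isUpperTriangular _ htri]
    simp [hB1]
  have hev (μ : F) : (e B).HasEigenvalue μ ↔ ∃ i : Fin (d + 1), μ = q ^ (2 * (i : ℤ) - d) := by
    rw [Module.End.hasEigenvalue_iff_isRoot_charpoly, hchar, Polynomial.isRoot_prod]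
    simp [sub_eq_zero]
  have hbe : qBracket q (e B) (e C) = 1 := by
    have := map_qBracket e.toAlgHom q B C
    rw [hBC, map_one] at this
    exact this.symm
  have hne : e (nilOf q B C) = nilOf q (e B) (e C) := map_nilOf e.toAlgHom q B C
  have hrange : (1 : Fin (d + 1) → F) ∈ LinearMap.range (nilOf q (e B) (e C) ^ d) := by
    refine ⟨w, ?_⟩
    rw [← hne, ← map_pow]
    exact hw
  -- the all-ones vector is an eigenvector of `B` and of `C`, that is, all row sums agree
  have h1 := apply_eq_of_mem_range_pow hq0 hq (by simp) (e B) _ hev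
    (nilOf_mul_left hq0 hs hbe) hrange
  have h2 := apply_eq_of_qBracket hq0 hq _ _ hev hbe h1
  have hBsum (i) : ∑ j, B i j = q ^ (-(d : ℤ)) := by
    have := congrFun h1 i
    simpa [e, Matrix.mulVec, dotProduct] using this
  have hCsum (i) : ∑ j, C i j = q ^ (d : ℤ) := by
    have := congrFun h2 i
    simpa [e, Matrix.mulVec, dotProduct] using this
  constructor
  · ext i j
    rw [lowerMat, of_apply]
    split_ifs with h h'
    · rw [← h, hB1]
    · rw [← hBsum i, ← hB1 i, Finset.sum_eq_add i j h (fun k _ hk => hB2 i k hk.1.symm fun hk' =>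
        hk.2 (by ext; omega)) (by simp) (by simp)]
      ring
    · exact hB2 i j h h'
  · ext i j
    rw [upperMat, of_apply]
    split_ifs with h h'
    · rw [← h, hC1]
    · rw [← hCsum i, ← hC1 i, Finset.sum_eq_add i j h (fun k _ hk => hC2 i k hk.1.symm fun hk' =>
        hk.2 (by ext; omega)) (by simp) (by simp)]
      ring
    · exact hC2 i j h h'

end matrices

/-! ### Products of the bidiagonal matrices, and conjugation by `Z` -/

section entries

open Matrix

theorem Z_apply (i j : Fin (d + 1)) : Z F d i j = if j = i.rev then 1 else 0 := by
  rw [Z, of_apply]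
  congr 1
  rw [Fin.ext_iff, Fin.val_rev, eq_iff_iff]
  omega

theorem conjZ_apply (B : Matrix (Fin (d + 1)) (Fin (d + 1)) F) (i j : Fin (d + 1)) :
    conjZ B i j = B i.rev j.rev := by
  have h (k : Fin (d + 1)) : (j = k.rev) = (k = j.rev) := by
    rw [eq_iff_iff]
    constructor
    · rintro rfl; simp
    · rintro rfl; simp
  simp [conjZ, mul_apply, Z_apply, h]

theorem conjZ_conjZ (B : Matrix (Fin (d + 1)) (Fin (d + 1)) F) : conjZ (conjZ B) = B := by
  ext i j; simp [conjZ_apply]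

theorem conjZ_neg (B : Matrix (Fin (d + 1)) (Fin (d + 1)) F) : conjZ (-B) = -conjZ B := by
  ext i j; simp [conjZ_apply]

theorem conjZ_transpose (B : Matrix (Fin (d + 1)) (Fin (d + 1)) F) : conjZ Bᵀ = (conjZ B)ᵀ := by
  ext i j; simp [conjZ_apply]

/-- The quantum integer `[n]` is the same for `q` and `q⁻¹`. -/
theorem qInt_inv (q : F) (n : ℤ) : qInt q⁻¹ n = qInt q n := by
  rw [qInt, qInt, inv_inv, _root_.inv_zpow', _root_.inv_zpow', neg_neg, ← neg_div_neg_eq,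
    neg_sub, neg_sub]

theorem sq_sub_one_ne_zero (hq0 : q ≠ 0) (hs : q - q⁻¹ ≠ 0) : q ^ 2 - 1 ≠ 0 := by
  intro h
  apply hs
  field_simp
  simpa using h

theorem conjZ_T (hq0 : q ≠ 0) (hs : q - q⁻¹ ≠ 0) : conjZ (T d q) = -T d q⁻¹ := by
  have hs2 := sq_sub_one_ne_zero hq0 hs
  ext i j
  rw [conjZ_apply, Matrix.neg_apply, T, T, of_apply, of_apply]
  simp only [Fin.val_rev, Fin.rev_inj, qInt_inv]
  obtain ⟨i, hi⟩ := i
  obtain ⟨j, hj⟩ := j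
  simp only [Fin.mk.injEq]
  rcases lt_trichotomy i j with hij | rfl | hij
  · by_cases h : j = i + 1
    · subst h
      rw [if_pos (by omega), if_neg (by omega), if_pos rfl]
      obtain ⟨k, rfl⟩ : ∃ k, d = i + 1 + k := ⟨d - (i + 1), by omega⟩
      rw [show i + 1 + k + 1 - (i + 1) = k + 1 by omega]
      -- expanding the exponents leaves a rational identity in `q`, `q ^ i` and `q ^ k`
      have hi : q ^ i ≠ 0 := pow_ne_zero i hq0
      have hk : q ^ k ≠ 0 := pow_ne_zero k hq0
      simp only [qInt, _root_.inv_zpow', Nat.cast_add, Nat.cast_one, mul_add, neg_add,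
        neg_sub, zpow_add₀ hq0, zpow_sub₀ hq0, _root_.zpow_neg, _root_.zpow_mul', zpow_natCast,
        zpow_ofNat, mul_one]
      generalize q ^ i = x at *
      generalize q ^ k = y at *
      field_simp
    · rw [if_neg (by omega), if_neg (by omega), if_neg (by omega), if_neg (by omega),
        if_neg (by omega), if_neg (by omega), neg_zero]
  · rw [if_neg (by omega), if_neg (by omega), if_pos rfl, if_neg (by omega), if_neg (by omega),
      if_pos rfl]
    obtain ⟨k, rfl⟩ : ∃ k, d = i + k := ⟨d - i, by omega⟩
    rw [show i + k + 1 - (i + 1) = k by omega]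
    have hi : q ^ i ≠ 0 := pow_ne_zero i hq0
    have hk : q ^ k ≠ 0 := pow_ne_zero k hq0
    simp only [qInt, _root_.inv_zpow', Nat.cast_add, neg_add,
      neg_sub, zpow_add₀ hq0, zpow_sub₀ hq0, _root_.zpow_neg, _root_.zpow_mul', zpow_natCast,
      zpow_ofNat]
    generalize q ^ i = x at *
    generalize q ^ k = y at *
    field_simp
    ring
  · by_cases h : i = j + 1
    · subst h
      rw [if_neg (by omega), if_pos (by omega), if_pos rfl]
      obtain ⟨k, rfl⟩ : ∃ k, d = j + 1 + k := ⟨d - (j + 1), by omega⟩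
      rw [show j + 1 + k + 1 - (j + 1) = k + 1 by omega]
      have hj : q ^ j ≠ 0 := pow_ne_zero j hq0
      have hk : q ^ k ≠ 0 := pow_ne_zero k hq0
      simp only [qInt, _root_.inv_zpow', Nat.cast_add, Nat.cast_one, mul_add, neg_add,
        neg_sub, zpow_add₀ hq0, zpow_sub₀ hq0, _root_.zpow_neg, _root_.zpow_mul', zpow_natCast,
        zpow_ofNat, mul_one]
      generalize q ^ j = x at *
      generalize q ^ k = y at *
      field_simp
    · rw [if_neg (by omega), if_neg (by omega), if_neg (by omega), if_neg (by omega),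
        if_neg (by omega), if_neg (by omega), neg_zero]

theorem nilOf_diagMat_lowerMat (hq0 : q ≠ 0) (hs : q - q⁻¹ ≠ 0) :
    nilOf q (diagMat d q) (lowerMat d q) = N d q := by
  have hs2 := sq_sub_one_ne_zero hq0 hs
  ext i j
  rw [nilOf, diagMat, Matrix.smul_apply, Matrix.sub_apply, diagonal_mul, lowerMat, of_apply, N,
    of_apply]
  obtain ⟨i, hi⟩ := i
  obtain ⟨j, hj⟩ := j
  simp only [Fin.mk.injEq, one_apply, smul_eq_mul]
  rcases lt_trichotomy i j with hij | rfl | hij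
  · rw [if_neg (by omega), if_neg (by omega), if_neg (by omega), if_neg (by omega)]
    simp
  · rw [if_pos rfl, if_pos rfl, if_neg (by omega), ← zpow_add₀ hq0]
    simp
  · rw [if_neg (by omega), if_neg (by omega)]
    split_ifs with h
    · subst h
      rw [zero_sub]
      have hj : q ^ j ≠ 0 := pow_ne_zero j hq0
      have hd : q ^ d ≠ 0 := pow_ne_zero d hq0
      simp only [qInt, Nat.cast_add, Nat.cast_one, mul_add, neg_add,
        zpow_add₀ hq0, zpow_sub₀ hq0, _root_.zpow_neg, _root_.zpow_mul', zpow_natCast,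
        zpow_ofNat, mul_one]
      generalize q ^ j = x at *
      generalize q ^ d = y at *
      field_simp
      ring
    · simp

theorem nilOf_upperMat_diagMat (hq0 : q ≠ 0) (hs : q - q⁻¹ ≠ 0) :
    nilOf q (upperMat d q) (diagMat d q) = -conjZ (N d q⁻¹) := by
  have hs2 := sq_sub_one_ne_zero hq0 hs
  ext i j
  rw [nilOf, diagMat, Matrix.smul_apply, Matrix.sub_apply, mul_diagonal, upperMat, of_apply,
    Matrix.neg_apply, conjZ_apply, N, of_apply]
  obtain ⟨i, hi⟩ := i
  obtain ⟨j, hj⟩ := j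
  simp only [Fin.mk.injEq, one_apply, Fin.val_rev, qInt_inv, smul_eq_mul]
  rcases lt_trichotomy j i with hij | rfl | hij
  · rw [if_neg (by omega), if_neg (by omega), if_neg (by omega), if_neg (by omega)]
    simp
  · rw [if_pos rfl, if_pos rfl, if_neg (by omega), ← zpow_add₀ hq0]
    simp
  · rw [if_neg (by omega), if_neg (by omega)]
    by_cases h : j = i + 1
    · rw [if_pos h, if_pos (by omega)]
      subst h
      obtain ⟨k, rfl⟩ : ∃ k, d = i + 1 + k := ⟨d - (i + 1), by omega⟩
      rw [zero_sub, show i + 1 + k + 1 - (i + 1) = k + 1 by omega]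
      have hi : q ^ i ≠ 0 := pow_ne_zero i hq0
      have hk : q ^ k ≠ 0 := pow_ne_zero k hq0
      simp only [qInt, _root_.inv_zpow', Nat.cast_add, Nat.cast_one, mul_add, neg_add,
        neg_sub, zpow_add₀ hq0, zpow_sub₀ hq0, _root_.zpow_neg, _root_.zpow_mul', zpow_natCast,
        zpow_ofNat, mul_one]
      generalize q ^ i = x at *
      generalize q ^ k = y at *
      field_simp
    · rw [if_neg h, if_neg (by omega)]
      simp

/-- For `i = 0` there is no entry left of the diagonal in row `i` of `lowerMat`; the formula still
holds because its coefficient `q^{-d} - q^{2i-d}` is then zero. -/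
theorem lowerMat_mul_upperMat_apply (i j : Fin (d + 1)) :
    (lowerMat d q * upperMat d q) i j =
      q ^ (2 * (i : ℤ) - d) * upperMat d q i j +
        (q ^ (-(d : ℤ)) - q ^ (2 * (i : ℤ) - d)) *
          if (i : ℕ) = (j : ℕ) + 1 then q ^ (2 * (j : ℤ) - d)
          else if i = j then q ^ (d : ℤ) - q ^ (2 * (i : ℤ) - 2 - d) else 0 := by
  rw [mul_apply]
  by_cases h : (i : ℕ) = 0
  · have h0 : q ^ (-(d : ℤ)) - q ^ (2 * (i : ℤ) - d) = 0 := by simp [h]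
    rw [h0, zero_mul, add_zero, Finset.sum_eq_single i _ (by simp)]
    · simp [lowerMat]
    · rintro k - h1
      simp only [lowerMat, of_apply]
      rw [if_neg h1.symm, if_neg (by omega), zero_mul]
  · obtain ⟨k, hk⟩ : ∃ k : Fin (d + 1), (i : ℕ) = (k : ℕ) + 1 :=
      ⟨⟨i - 1, by omega⟩, by simp only; omega⟩
    have hne : i ≠ k := by
      rintro rfl; omega
    rw [Finset.sum_eq_add i k hne _ (by simp) (by simp)]
    · simp only [lowerMat, of_apply, if_true, if_neg hne, if_pos hk]
      congr 2
      have h1 : (k = j) = ((i : ℕ) = (j : ℕ) + 1) := by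
        rw [Fin.ext_iff, eq_iff_iff]; omega
      have h2 : ((j : ℕ) = (k : ℕ) + 1) = (i = j) := by
        rw [Fin.ext_iff, eq_iff_iff]; omega
      have h3 : (2 * (i : ℤ) - 2 - d) = 2 * (k : ℤ) - d := by
        rw [hk]; push_cast; ring
      simp only [upperMat, of_apply, h1, h2, h3]
      split_ifs with h4
      · have h5 : (j : ℕ) = k := by omega
        rw [h5]
      · rfl
      · rfl
    · rintro l - ⟨h1, h2⟩
      have h2' : (l : ℕ) ≠ k := fun h' => h2 (Fin.ext h')
      simp only [lowerMat, of_apply]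
      rw [if_neg h1.symm, if_neg (by omega), zero_mul]

theorem nilOf_lowerMat_upperMat (hq0 : q ≠ 0) (hs : q - q⁻¹ ≠ 0) :
    nilOf q (lowerMat d q) (upperMat d q) = T d q := by
  have hs2 := sq_sub_one_ne_zero hq0 hs
  ext i j
  rw [nilOf, Matrix.smul_apply, Matrix.sub_apply, lowerMat_mul_upperMat_apply, T, of_apply]
  obtain ⟨i, hi⟩ := i
  obtain ⟨j, hj⟩ := j
  simp only [Fin.mk.injEq, one_apply, upperMat, of_apply, smul_eq_mul]
  rcases lt_trichotomy i j with hij | rfl | hij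
  · simp only [if_neg (show ¬ i = j by omega), if_neg (show ¬ i = j + 1 by omega)]
    by_cases h : j = i + 1
    · subst h
      rw [if_pos rfl, if_pos rfl, zero_sub, mul_zero, add_zero]
      obtain ⟨k, rfl⟩ : ∃ k, d = i + 1 + k := ⟨d - (i + 1), by omega⟩
      have hi : q ^ i ≠ 0 := pow_ne_zero i hq0
      have hk : q ^ k ≠ 0 := pow_ne_zero k hq0
      simp only [qInt, Nat.cast_add, Nat.cast_one, mul_add, neg_add, neg_sub, zpow_add₀ hq0,
        zpow_sub₀ hq0, _root_.zpow_neg, _root_.zpow_mul', zpow_natCast, zpow_ofNat,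
        mul_one]
      generalize q ^ i = x at *
      generalize q ^ k = y at *
      field_simp
    · simp [if_neg h]
  · simp only [if_neg (show ¬ i = i + 1 by omega), if_true]
    obtain ⟨k, rfl⟩ : ∃ k, d = i + k := ⟨d - i, by omega⟩
    have hi : q ^ i ≠ 0 := pow_ne_zero i hq0
    have hk : q ^ k ≠ 0 := pow_ne_zero k hq0
    simp only [qInt, Nat.cast_add, neg_add, neg_sub, zpow_add₀ hq0,
      zpow_sub₀ hq0, _root_.zpow_neg, _root_.zpow_mul', zpow_natCast, zpow_ofNat]
    generalize q ^ i = x at *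
    generalize q ^ k = y at *
    field_simp
    ring
  · simp only [if_neg (show ¬ i = j by omega), if_neg (show ¬ j = i + 1 by omega)]
    by_cases h : i = j + 1
    · subst h
      rw [if_pos rfl, if_pos rfl, zero_sub, mul_zero, zero_add]
      obtain ⟨k, rfl⟩ : ∃ k, d = j + 1 + k := ⟨d - (j + 1), by omega⟩
      have hj : q ^ j ≠ 0 := pow_ne_zero j hq0
      have hk : q ^ k ≠ 0 := pow_ne_zero k hq0
      simp only [qInt, Nat.cast_add, Nat.cast_one, mul_add, neg_add, zpow_add₀ hq0,
        zpow_sub₀ hq0, _root_.zpow_neg, _root_.zpow_mul', zpow_natCast, zpow_ofNat,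
        mul_one]
      generalize q ^ j = x at *
      generalize q ^ k = y at *
      field_simp
      ring
    · simp [if_neg h]

end entries

/-! ### Row bases -/

section representations

open Matrix

variable {V : Type*} [AddCommGroup V] [Module F V]

/-- In an eigenbasis of `a` whose sum lies in the range of `n_a ^ d`, the elements `n_a`, `n_b` and
`n_c` have the matrices `T_q`, `-Z N_{q⁻¹} Z` and `N_q`. The relations are invariant under cyclic
permutation of the generators, so this covers all three kinds of row bases. -/
theorem toMatrix_nilOf (hq0 : q ≠ 0) (hq : ∀ n : ℕ, 0 < n → q ^ n ≠ 1) {a b c : Module.End F V}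
    (hab : qBracket q a b = 1) (hbc : qBracket q b c = 1) (hca : qBracket q c a = 1)
    (v : Module.Basis (Fin (d + 1)) F V)
    (hv : ∀ i : Fin (d + 1), a (v i) = q ^ ((d : ℤ) - 2 * (i : ℤ)) • v i)
    (hsum : ∑ i, v i ∈ LinearMap.range (nilOf q b c ^ d)) :
    LinearMap.toMatrix v v (nilOf q b c) = T d q ∧
      LinearMap.toMatrix v v (nilOf q c a) = -conjZ (N d q⁻¹) ∧
      LinearMap.toMatrix v v (nilOf q a b) = N d q := by
  have hs := sub_inv_ne_zero hq0 hq
  let e : Module.End F V ≃ₐ[F] Matrix (Fin (d + 1)) (Fin (d + 1)) F := LinearMap.toMatrixAlgEquiv v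
  have hbr {s t : Module.End F V} (h : qBracket q s t = 1) : qBracket q (e s) (e t) = 1 := by
    have := map_qBracket e.toAlgHom q s t
    rw [h, map_one] at this
    exact this.symm
  have hnil (s t : Module.End F V) : e (nilOf q s t) = nilOf q (e s) (e t) :=
    map_nilOf e.toAlgHom q s t
  have hea : e a = diagMat d q := by
    ext i j
    change LinearMap.toMatrix v v a i j = _
    rw [LinearMap.toMatrix_apply, hv, diagMat, diagonal_apply]
    by_cases h : i = j
    · simp [h]
    · simp [h]
  obtain ⟨w, hw⟩ := hsum
  have hw' : (nilOf q (e b) (e c) ^ d) *ᵥ (v.repr w) = 1 := by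
    rw [← hnil, ← map_pow]
    change LinearMap.toMatrix v v _ *ᵥ _ = _
    rw [LinearMap.toMatrix_mulVec_repr, hw]
    ext i
    simp [Finsupp.single_apply]
  obtain ⟨hb, hc⟩ := eq_lowerMat_and_eq_upperMat hq0 hq (hea ▸ hbr hab) (hea ▸ hbr hca)
    (hbr hbc) hw'
  refine ⟨?_, ?_, ?_⟩
  · rw [← nilOf_lowerMat_upperMat hq0 hs, ← hb, ← hc]; exact hnil b c
  · rw [← nilOf_upperMat_diagMat hq0 hs, ← hc, ← hea]; exact hnil c a
  · rw [← nilOf_diagMat_lowerMat hq0 hs, ← hb, ← hea]; exact hnil a b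

theorem Uq.qBracket_x_y (q : F) : qBracket q (Uq.x q) (Uq.y q) = 1 := by
  have := Uq.of_rel (Relation.xy (F := F) (q := q))
  simp only [map_qBracket, map_one, FreeAlgebra.lift_ι_apply] at this
  exact this

theorem Uq.qBracket_y_z (q : F) : qBracket q (Uq.y q) (Uq.z q) = 1 := by
  have := Uq.of_rel (Relation.yz (F := F) (q := q))
  simp only [map_qBracket, map_one, FreeAlgebra.lift_ι_apply] at this
  exact this

theorem Uq.qBracket_z_x (q : F) : qBracket q (Uq.z q) (Uq.x q) = 1 := by
  have := Uq.of_rel (Relation.zx (F := F) (q := q))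
  simp only [map_qBracket, map_one, FreeAlgebra.lift_ι_apply] at this
  exact this

theorem qBracket_rep (ρ : Uq F q →ₐ[F] Module.End F V) :
    qBracket q (ρ (Uq.x q)) (ρ (Uq.y q)) = 1 ∧ qBracket q (ρ (Uq.y q)) (ρ (Uq.z q)) = 1 ∧
      qBracket q (ρ (Uq.z q)) (ρ (Uq.x q)) = 1 := by
  simp only [← map_qBracket, Uq.qBracket_x_y, Uq.qBracket_y_z, Uq.qBracket_z_x, map_one, and_self]

theorem nilOf_rep (ρ : Uq F q →ₐ[F] Module.End F V) :
    ρ (Uq.nx q) = nilOf q (ρ (Uq.y q)) (ρ (Uq.z q)) ∧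
      ρ (Uq.ny q) = nilOf q (ρ (Uq.z q)) (ρ (Uq.x q)) ∧
      ρ (Uq.nz q) = nilOf q (ρ (Uq.x q)) (ρ (Uq.y q)) :=
  ⟨map_nilOf ρ q _ _, map_nilOf ρ q _ _, map_nilOf ρ q _ _⟩

/-- A row basis for `x`; the parameter `p` stands for `q⁻¹`, so that the lemma reads well for
`U_{q⁻¹}` too. -/
theorem nilMatrices_of_isRow_x {p : F} (hp : q⁻¹ = p) (hq0 : q ≠ 0)
    (hq : ∀ n : ℕ, 0 < n → q ^ n ≠ 1) {ρ : Uq F q →ₐ[F] Module.End F V}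
    {v : Module.Basis (Fin (d + 1)) F V} (h : IsRow ρ .x v) :
    NilMatrices ρ v (T d q) (-conjZ (N d p)) (N d q) := by
  subst hp
  obtain ⟨hxy, hyz, hzx⟩ := qBracket_rep ρ
  obtain ⟨hx, hy, hz⟩ := nilOf_rep ρ
  have hsum : ∑ i, v i ∈ LinearMap.range (ρ (Uq.nx q) ^ d) := h.2
  rw [hx] at hsum
  obtain ⟨h1, h2, h3⟩ := toMatrix_nilOf hq0 hq hxy hyz hzx v
    (fun i => Module.End.mem_eigenspace_iff.1 (h.1 i)) hsum
  exact ⟨hx ▸ h1, hy ▸ h2, hz ▸ h3⟩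

/-- A row basis for `y`; the parameter `p` stands for `q⁻¹`, so that the lemma reads well for
`U_{q⁻¹}` too. -/
theorem nilMatrices_of_isRow_y {p : F} (hp : q⁻¹ = p) (hq0 : q ≠ 0)
    (hq : ∀ n : ℕ, 0 < n → q ^ n ≠ 1) {ρ : Uq F q →ₐ[F] Module.End F V}
    {v : Module.Basis (Fin (d + 1)) F V} (h : IsRow ρ .y v) :
    NilMatrices ρ v (N d q) (T d q) (-conjZ (N d p)) := by
  subst hp
  obtain ⟨hxy, hyz, hzx⟩ := qBracket_rep ρ
  obtain ⟨hx, hy, hz⟩ := nilOf_rep ρ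
  have hsum : ∑ i, v i ∈ LinearMap.range (ρ (Uq.ny q) ^ d) := h.2
  rw [hy] at hsum
  obtain ⟨h1, h2, h3⟩ := toMatrix_nilOf hq0 hq hyz hzx hxy v
    (fun i => Module.End.mem_eigenspace_iff.1 (h.1 i)) hsum
  exact ⟨hx ▸ h3, hy ▸ h1, hz ▸ h2⟩

/-- A row basis for `z`; the parameter `p` stands for `q⁻¹`, so that the lemma reads well for
`U_{q⁻¹}` too. -/
theorem nilMatrices_of_isRow_z {p : F} (hp : q⁻¹ = p) (hq0 : q ≠ 0)
    (hq : ∀ n : ℕ, 0 < n → q ^ n ≠ 1) {ρ : Uq F q →ₐ[F] Module.End F V}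
    {v : Module.Basis (Fin (d + 1)) F V} (h : IsRow ρ .z v) :
    NilMatrices ρ v (-conjZ (N d p)) (N d q) (T d q) := by
  subst hp
  obtain ⟨hxy, hyz, hzx⟩ := qBracket_rep ρ
  obtain ⟨hx, hy, hz⟩ := nilOf_rep ρ
  have hsum : ∑ i, v i ∈ LinearMap.range (ρ (Uq.nz q) ^ d) := h.2
  rw [hz] at hsum
  obtain ⟨h1, h2, h3⟩ := toMatrix_nilOf hq0 hq hzx hxy hyz v
    (fun i => Module.End.mem_eigenspace_iff.1 (h.1 i)) hsum
  exact ⟨hx ▸ h2, hy ▸ h3, hz ▸ h1⟩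

/-! ### Inversion and duality -/

theorem toMatrix_inversion (v : Module.Basis (Fin (d + 1)) F V) (φ : Module.End F V) :
    LinearMap.toMatrix (inversion v) (inversion v) φ = conjZ (LinearMap.toMatrix v v φ) := by
  ext i j
  rw [conjZ_apply, LinearMap.toMatrix_apply, LinearMap.toMatrix_apply]
  simp [inversion]

theorem NilMatrices.inversion {ρ : Uq F q →ₐ[F] Module.End F V}
    {v : Module.Basis (Fin (d + 1)) F V} {A B C : Matrix (Fin (d + 1)) (Fin (d + 1)) F}
    (h : NilMatrices ρ v A B C) :
    NilMatrices ρ (inversion v) (conjZ A) (conjZ B) (conjZ C) := by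
  obtain ⟨rfl, rfl, rfl⟩ := h
  exact ⟨toMatrix_inversion v _, toMatrix_inversion v _, toMatrix_inversion v _⟩

theorem AreDual.toMatrix_dualMap {u : Module.Basis (Fin (d + 1)) F V}
    {f : Module.Basis (Fin (d + 1)) F (Module.Dual F V)} (h : AreDual u f)
    (φ : Module.End F V) :
    LinearMap.toMatrix f f φ.dualMap = (LinearMap.toMatrix u u φ)ᵀ := by
  ext i j
  rw [transpose_apply, LinearMap.toMatrix_apply, LinearMap.toMatrix_apply]
  have h1 (g : Module.Dual F V) : f.repr g i = g (u i) := by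
    have e : ∑ k, f.repr g k * f k (u i) = g (u i) := by
      conv_rhs => rw [← f.sum_repr g]
      simp only [LinearMap.sum_apply, LinearMap.smul_apply, smul_eq_mul]
    simpa [h i] using e
  have h2 (w : V) : u.repr w j = f j w := by
    have e : ∑ k, u.repr w k * f j (u k) = f j w := by
      conv_rhs => rw [← u.sum_repr w]
      simp only [map_sum, map_smul, smul_eq_mul]
    simpa [h _ j] using e
  rw [h1, h2, LinearMap.dualMap_apply]

/-- Reversing multiplication replaces `q` by `q⁻¹` in the relation between `b` and `c`, and under
that relation `q(1 - cb) = q⁻¹(1 - bc)`. -/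
theorem nilOf_op {A : Type*} [Ring A] [Algebra F A] (hs : q - q⁻¹ ≠ 0) {b c : A}
    (h : qBracket q⁻¹ b c = 1) :
    nilOf q (MulOpposite.op b) (MulOpposite.op c) = -MulOpposite.op (nilOf q⁻¹ b c) := by
  have hs' : q⁻¹ - q⁻¹⁻¹ ≠ 0 := by rwa [inv_inv, ← neg_sub, neg_ne_zero]
  rw [qBracket_eq_one_iff hs', inv_inv] at h
  have h1 : q • (1 - c * b) = q⁻¹ • (1 - b * c) := by
    rw [sub_smul, sub_eq_sub_iff_add_eq_add] at h
    rw [smul_sub, smul_sub, sub_eq_sub_iff_add_eq_add, add_comm (q • (1 : A)), h]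
  have h2 : (q⁻¹ - q)⁻¹ = -(q - q⁻¹)⁻¹ := by rw [← inv_neg, neg_sub]
  rw [nilOf, nilOf, ← MulOpposite.op_mul, ← MulOpposite.op_one, ← MulOpposite.op_sub,
    ← MulOpposite.op_smul, ← MulOpposite.op_neg, inv_inv, div_eq_inv_mul, div_eq_inv_mul,
    mul_smul, mul_smul, h1, h2, neg_smul, neg_neg]

/-- If `†` sends `ζ` to `-η`, then `η` acts on the dual space as minus the adjoint of `ζ`. -/
theorem dualRep_of_dagger (ρ : Uq F q →ₐ[F] Module.End F V) {ζ : Uq F q} {η : Uq F q⁻¹}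
    (h : dagger q ζ = -MulOpposite.op η) : dualRep ρ η = -(ρ ζ).dualMap := by
  have h1 : (dagger q).symm (MulOpposite.op η) = -ζ := by
    rw [AlgEquiv.symm_apply_eq, map_neg, h, neg_neg]
  change (ρ ((dagger q).symm (MulOpposite.op η))).dualMap = _
  rw [h1, map_neg]
  ext g w
  simp

theorem dagger_nilOf (a b : Uq F q) :
    dagger q (nilOf q a b) = nilOf q (dagger q a) (dagger q b) :=
  map_nilOf (dagger q).toAlgHom q a b

/-- The antiisomorphism `†` sends each nilpotent element of `U_q` to the negative of its namesake in
`U_{q⁻¹}`, so passing to the dual basis replaces the representing matrices by the negatives of their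
transposes. -/
theorem AreDual.toMatrix_dualRep (hs : q - q⁻¹ ≠ 0)
    {ρ : Uq F q →ₐ[F] Module.End F V} {u : Module.Basis (Fin (d + 1)) F V}
    {f : Module.Basis (Fin (d + 1)) F (Module.Dual F V)} (h : AreDual u f) :
    NilMatrices (dualRep ρ) f (-(LinearMap.toMatrix u u (ρ (Uq.nx q)))ᵀ)
      (-(LinearMap.toMatrix u u (ρ (Uq.ny q)))ᵀ) (-(LinearMap.toMatrix u u (ρ (Uq.nz q)))ᵀ) := by
  have key {ζ : Uq F q} {η : Uq F q⁻¹} (h' : dagger q ζ = -MulOpposite.op η) :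
      LinearMap.toMatrix f f (dualRep ρ η) = -(LinearMap.toMatrix u u (ρ ζ))ᵀ := by
    rw [dualRep_of_dagger ρ h', ← h.toMatrix_dualMap]
    exact map_neg (LinearMap.toMatrix f f) _
  have hx : dagger q (Uq.x q) = MulOpposite.op (Uq.x q⁻¹) := dagger_of q .x
  have hy : dagger q (Uq.y q) = MulOpposite.op (Uq.y q⁻¹) := dagger_of q .y
  have hz : dagger q (Uq.z q) = MulOpposite.op (Uq.z q⁻¹) := dagger_of q .z
  refine ⟨key ?_, key ?_, key ?_⟩
  · refine (dagger_nilOf (Uq.y q) (Uq.z q)).trans ?_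
    rw [hy, hz]
    exact nilOf_op hs (Uq.qBracket_y_z q⁻¹)
  · refine (dagger_nilOf (Uq.z q) (Uq.x q)).trans ?_
    rw [hz, hx]
    exact nilOf_op hs (Uq.qBracket_z_x q⁻¹)
  · refine (dagger_nilOf (Uq.x q) (Uq.y q)).trans ?_
    rw [hx, hy]
    exact nilOf_op hs (Uq.qBracket_x_y q⁻¹)

theorem NilMatrices.dual (hs : q - q⁻¹ ≠ 0) {ρ : Uq F q →ₐ[F] Module.End F V}
    {u : Module.Basis (Fin (d + 1)) F V} {f : Module.Basis (Fin (d + 1)) F (Module.Dual F V)}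
    (hd : AreDual u f) {A B C : Matrix (Fin (d + 1)) (Fin (d + 1)) F} (h : NilMatrices ρ u A B C) :
    NilMatrices (dualRep ρ) f (-Aᵀ) (-Bᵀ) (-Cᵀ) := by
  obtain ⟨rfl, rfl, rfl⟩ := h
  exact hd.toMatrix_dualRep hs

theorem NilMatrices.predual (hs : q - q⁻¹ ≠ 0) {ρ : Uq F q →ₐ[F] Module.End F V}
    {u : Module.Basis (Fin (d + 1)) F V} {f : Module.Basis (Fin (d + 1)) F (Module.Dual F V)}
    (hd : AreDual u f) {A B C : Matrix (Fin (d + 1)) (Fin (d + 1)) F}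
    (h : NilMatrices (dualRep ρ) f A B C) : NilMatrices ρ u (-Aᵀ) (-Bᵀ) (-Cᵀ) := by
  obtain ⟨h1, h2, h3⟩ := hd.toMatrix_dualRep (ρ := ρ) hs
  obtain ⟨rfl, rfl, rfl⟩ := h
  rw [h1, h2, h3]
  simp [NilMatrices]

/-! ### From row bases to the other kinds of bases -/

section table

variable {ρ : Uq F q →ₐ[F] Module.End F V} {ξ : Axis}
  {A B C : Matrix (Fin (d + 1)) (Fin (d + 1)) F}

theorem nilMatrices_of_isInvRow (h : ∀ w : Module.Basis (Fin (d + 1)) F V,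
    IsRow ρ ξ w → NilMatrices ρ w A B C) {v : Module.Basis (Fin (d + 1)) F V}
    (hv : IsInvRow ρ ξ v) : NilMatrices ρ v (conjZ A) (conjZ B) (conjZ C) := by
  obtain ⟨w, hw, rfl⟩ := hv
  exact (h w hw).inversion

theorem nilMatrices_of_isCol (hs : q - q⁻¹ ≠ 0)
    (h : ∀ w : Module.Basis (Fin (d + 1)) F (Module.Dual F V),
      IsRow (dualRep ρ) ξ w → NilMatrices (dualRep ρ) w A B C)
    {v : Module.Basis (Fin (d + 1)) F V} (hv : IsCol ρ ξ v) :
    NilMatrices ρ v (-(conjZ A)ᵀ) (-(conjZ B)ᵀ) (-(conjZ C)ᵀ) := by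
  obtain ⟨f, hf, hd⟩ := hv
  exact (nilMatrices_of_isInvRow h hf).predual hs hd

theorem nilMatrices_of_isInvCol (hs : q - q⁻¹ ≠ 0)
    (h : ∀ w : Module.Basis (Fin (d + 1)) F (Module.Dual F V),
      IsRow (dualRep ρ) ξ w → NilMatrices (dualRep ρ) w A B C)
    {v : Module.Basis (Fin (d + 1)) F V} (hv : IsInvCol ρ ξ v) :
    NilMatrices ρ v (-Aᵀ) (-Bᵀ) (-Cᵀ) := by
  obtain ⟨w, hw, rfl⟩ := hv
  simpa only [conjZ_neg, conjZ_transpose, conjZ_conjZ] using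
    (nilMatrices_of_isCol hs h hw).inversion

theorem nilMatrices_of_isDualCol (hs : q - q⁻¹ ≠ 0)
    (h : ∀ w : Module.Basis (Fin (d + 1)) F V, IsRow ρ ξ w → NilMatrices ρ w A B C)
    {f : Module.Basis (Fin (d + 1)) F (Module.Dual F V)} (hf : IsDualCol ρ ξ f) :
    NilMatrices (dualRep ρ) f (-(conjZ A)ᵀ) (-(conjZ B)ᵀ) (-(conjZ C)ᵀ) := by
  obtain ⟨v, hv, hd⟩ := hf
  exact (nilMatrices_of_isInvRow h hv).dual hs hd

theorem nilMatrices_of_isDualInvCol (hs : q - q⁻¹ ≠ 0)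
    (h : ∀ w : Module.Basis (Fin (d + 1)) F V, IsRow ρ ξ w → NilMatrices ρ w A B C)
    {f : Module.Basis (Fin (d + 1)) F (Module.Dual F V)} (hf : IsDualInvCol ρ ξ f) :
    NilMatrices (dualRep ρ) f (-Aᵀ) (-Bᵀ) (-Cᵀ) := by
  obtain ⟨g, hg, rfl⟩ := hf
  simpa only [conjZ_neg, conjZ_transpose, conjZ_conjZ] using
    (nilMatrices_of_isDualCol hs h hg).inversion

end table

end representations

end EquitableSl2

end

open EquitableSl2 in
open scoped Matrix in
theorem mainTheorem7 {F : Type*} [Field F] (q : F) (hq0 : q ≠ 0)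
    (hq : ∀ n : ℕ, 0 < n → q ^ n ≠ 1) (d : ℕ)
    {V : Type*} [AddCommGroup V] [Module F V] [Module (Uq F q) V] [IsScalarTower F (Uq F q) V]
    [IsSimpleModule (Uq F q) V] (hdim : Module.finrank F V = d + 1)
    (htype : HasType (moduleRep q V) d 1) :
    let ρ : Uq F q →ₐ[F] Module.End F V := moduleRep q V
    let ρ' : Uq F q⁻¹ →ₐ[F] Module.End F (Module.Dual F V) := dualRep ρ
    (∀ v : Module.Basis (Fin (d + 1)) F V,
      (IsRow ρ .x v → NilMatrices ρ v (T d q) (-(conjZ (N d q⁻¹))) (N d q)) ∧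
      (IsCol ρ .x v → NilMatrices ρ v (T d q)ᵀ (N d q)ᵀ (-(conjZ (N d q⁻¹)ᵀ))) ∧
      (IsInvRow ρ .x v → NilMatrices ρ v (-(T d q⁻¹)) (-(N d q⁻¹)) (conjZ (N d q))) ∧
      (IsInvCol ρ .x v → NilMatrices ρ v (-(T d q⁻¹)ᵀ) (conjZ (N d q)ᵀ) (-(N d q⁻¹)ᵀ)) ∧
      (IsRow ρ .y v → NilMatrices ρ v (N d q) (T d q) (-(conjZ (N d q⁻¹)))) ∧
      (IsCol ρ .y v → NilMatrices ρ v (-(conjZ (N d q⁻¹)ᵀ)) (T d q)ᵀ (N d q)ᵀ) ∧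
      (IsInvRow ρ .y v → NilMatrices ρ v (conjZ (N d q)) (-(T d q⁻¹)) (-(N d q⁻¹))) ∧
      (IsInvCol ρ .y v → NilMatrices ρ v (-(N d q⁻¹)ᵀ) (-(T d q⁻¹)ᵀ) (conjZ (N d q)ᵀ)) ∧
      (IsRow ρ .z v → NilMatrices ρ v (-(conjZ (N d q⁻¹))) (N d q) (T d q)) ∧
      (IsCol ρ .z v → NilMatrices ρ v (N d q)ᵀ (-(conjZ (N d q⁻¹)ᵀ)) (T d q)ᵀ) ∧
      (IsInvRow ρ .z v → NilMatrices ρ v (-(N d q⁻¹)) (conjZ (N d q)) (-(T d q⁻¹))) ∧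
      (IsInvCol ρ .z v → NilMatrices ρ v (conjZ (N d q)ᵀ) (-(N d q⁻¹)ᵀ) (-(T d q⁻¹)ᵀ))) ∧
    (∀ f : Module.Basis (Fin (d + 1)) F (Module.Dual F V),
      (IsRow ρ' .x f → NilMatrices ρ' f (T d q⁻¹) (-(conjZ (N d q))) (N d q⁻¹)) ∧
      (IsDualCol ρ .x f → NilMatrices ρ' f (T d q⁻¹)ᵀ (N d q⁻¹)ᵀ (-(conjZ (N d q)ᵀ))) ∧
      (IsInvRow ρ' .x f → NilMatrices ρ' f (-(T d q)) (-(N d q)) (conjZ (N d q⁻¹))) ∧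
      (IsDualInvCol ρ .x f → NilMatrices ρ' f (-(T d q)ᵀ) (conjZ (N d q⁻¹)ᵀ) (-(N d q)ᵀ)) ∧
      (IsRow ρ' .y f → NilMatrices ρ' f (N d q⁻¹) (T d q⁻¹) (-(conjZ (N d q)))) ∧
      (IsDualCol ρ .y f → NilMatrices ρ' f (-(conjZ (N d q)ᵀ)) (T d q⁻¹)ᵀ (N d q⁻¹)ᵀ) ∧
      (IsInvRow ρ' .y f → NilMatrices ρ' f (conjZ (N d q⁻¹)) (-(T d q)) (-(N d q))) ∧
      (IsDualInvCol ρ .y f → NilMatrices ρ' f (-(N d q)ᵀ) (-(T d q)ᵀ) (conjZ (N d q⁻¹)ᵀ)) ∧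
      (IsRow ρ' .z f → NilMatrices ρ' f (-(conjZ (N d q))) (N d q⁻¹) (T d q⁻¹)) ∧
      (IsDualCol ρ .z f → NilMatrices ρ' f (N d q⁻¹)ᵀ (-(conjZ (N d q)ᵀ)) (T d q⁻¹)ᵀ) ∧
      (IsInvRow ρ' .z f → NilMatrices ρ' f (-(N d q)) (conjZ (N d q⁻¹)) (-(T d q))) ∧
      (IsDualInvCol ρ .z f → NilMatrices ρ' f (conjZ (N d q⁻¹)ᵀ) (-(N d q)ᵀ) (-(T d q)ᵀ))) := by
  intro ρ ρ'
  have hs := sub_inv_ne_zero hq0 hq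
  have hq0' : q⁻¹ ≠ 0 := inv_ne_zero hq0
  have hq' : ∀ n : ℕ, 0 < n → q⁻¹ ^ n ≠ 1 := fun n hn => by
    rw [inv_pow, inv_ne_one]
    exact hq n hn
  have hs' : q⁻¹ - q⁻¹⁻¹ ≠ 0 := sub_inv_ne_zero hq0' hq'
  have hT : conjZ (T d q) = -T d q⁻¹ := conjZ_T hq0 hs
  have hT' : conjZ (T d q⁻¹) = -T d q := by rw [conjZ_T hq0' hs', inv_inv]
  have hx (v : Module.Basis (Fin (d + 1)) F V) (h : IsRow ρ .x v) :=
    nilMatrices_of_isRow_x rfl hq0 hq h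
  have hy (v : Module.Basis (Fin (d + 1)) F V) (h : IsRow ρ .y v) :=
    nilMatrices_of_isRow_y rfl hq0 hq h
  have hz (v : Module.Basis (Fin (d + 1)) F V) (h : IsRow ρ .z v) :=
    nilMatrices_of_isRow_z rfl hq0 hq h
  have hx' (f : Module.Basis (Fin (d + 1)) F (Module.Dual F V)) (h : IsRow ρ' .x f) :=
    nilMatrices_of_isRow_x (inv_inv q) hq0' hq' h
  have hy' (f : Module.Basis (Fin (d + 1)) F (Module.Dual F V)) (h : IsRow ρ' .y f) :=
    nilMatrices_of_isRow_y (inv_inv q) hq0' hq' h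
  have hz' (f : Module.Basis (Fin (d + 1)) F (Module.Dual F V)) (h : IsRow ρ' .z f) :=
    nilMatrices_of_isRow_z (inv_inv q) hq0' hq' h
  constructor
  · intro v
    refine ⟨?_, ?_, ?_, ?_, ?_, ?_, ?_, ?_, ?_, ?_, ?_, ?_⟩
    · exact hx v
    · exact fun h => by
        simpa only [hT, hT', conjZ_neg, conjZ_transpose, conjZ_conjZ,
          Matrix.transpose_neg, neg_neg] using
          nilMatrices_of_isCol hs hx' h
    · exact fun h => by
        simpa only [hT, hT', conjZ_neg, conjZ_transpose, conjZ_conjZ,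
          Matrix.transpose_neg, neg_neg] using
          nilMatrices_of_isInvRow hx h
    · exact fun h => by
        simpa only [hT, hT', conjZ_neg, conjZ_transpose, conjZ_conjZ,
          Matrix.transpose_neg, neg_neg] using
          nilMatrices_of_isInvCol hs hx' h
    · exact hy v
    · exact fun h => by
        simpa only [hT, hT', conjZ_neg, conjZ_transpose, conjZ_conjZ,
          Matrix.transpose_neg, neg_neg] using
          nilMatrices_of_isCol hs hy' h
    · exact fun h => by
        simpa only [hT, hT', conjZ_neg, conjZ_transpose, conjZ_conjZ,
          Matrix.transpose_neg, neg_neg] using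
          nilMatrices_of_isInvRow hy h
    · exact fun h => by
        simpa only [hT, hT', conjZ_neg, conjZ_transpose, conjZ_conjZ,
          Matrix.transpose_neg, neg_neg] using
          nilMatrices_of_isInvCol hs hy' h
    · exact hz v
    · exact fun h => by
        simpa only [hT, hT', conjZ_neg, conjZ_transpose, conjZ_conjZ,
          Matrix.transpose_neg, neg_neg] using
          nilMatrices_of_isCol hs hz' h
    · exact fun h => by
        simpa only [hT, hT', conjZ_neg, conjZ_transpose, conjZ_conjZ,
          Matrix.transpose_neg, neg_neg] using
          nilMatrices_of_isInvRow hz h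
    · exact fun h => by
        simpa only [hT, hT', conjZ_neg, conjZ_transpose, conjZ_conjZ,
          Matrix.transpose_neg, neg_neg] using
          nilMatrices_of_isInvCol hs hz' h
  · intro f
    refine ⟨?_, ?_, ?_, ?_, ?_, ?_, ?_, ?_, ?_, ?_, ?_, ?_⟩
    · exact hx' f
    · exact fun h => by
        simpa only [hT, hT', conjZ_neg, conjZ_transpose, conjZ_conjZ,
          Matrix.transpose_neg, neg_neg] using
          nilMatrices_of_isDualCol hs hx h
    · exact fun h => by
        simpa only [hT, hT', conjZ_neg, conjZ_transpose, conjZ_conjZ,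
          Matrix.transpose_neg, neg_neg] using
          nilMatrices_of_isInvRow hx' h
    · exact fun h => by
        simpa only [hT, hT', conjZ_neg, conjZ_transpose, conjZ_conjZ,
          Matrix.transpose_neg, neg_neg] using
          nilMatrices_of_isDualInvCol hs hx h
    · exact hy' f
    · exact fun h => by
        simpa only [hT, hT', conjZ_neg, conjZ_transpose, conjZ_conjZ,
          Matrix.transpose_neg, neg_neg] using
          nilMatrices_of_isDualCol hs hy h
    · exact fun h => by
        simpa only [hT, hT', conjZ_neg, conjZ_transpose, conjZ_conjZ,
          Matrix.transpose_neg, neg_neg] using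
          nilMatrices_of_isInvRow hy' h
    · exact fun h => by
        simpa only [hT, hT', conjZ_neg, conjZ_transpose, conjZ_conjZ,
          Matrix.transpose_neg, neg_neg] using
          nilMatrices_of_isDualInvCol hs hy h
    · exact hz' f
    · exact fun h => by
        simpa only [hT, hT', conjZ_neg, conjZ_transpose, conjZ_conjZ,
          Matrix.transpose_neg, neg_neg] using
          nilMatrices_of_isDualCol hs hz h
    · exact fun h => by
        simpa only [hT, hT', conjZ_neg, conjZ_transpose, conjZ_conjZ,
          Matrix.transpose_neg, neg_neg] using
          nilMatrices_of_isInvRow hz' h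
    · exact fun h => by
        simpa only [hT, hT', conjZ_neg, conjZ_transpose, conjZ_conjZ,
          Matrix.transpose_neg, neg_neg] using
          nilMatrices_of_isDualInvCol hs hz h
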